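/- **Setting.** Let $U\subseteq\mathbb R^4$ be the domain of a chart with coordinates $(x^0,x^1,x^2,x^3)$, and let $g_{ij}$ be a smooth, not necessarily symmetric, metric on $U$ whose symmetric part $g_{\underline{ij}}=\frac12(g_{ij}+g_{ji})$ is non-singular, with inverse $g^{\underline{ij}}$ (a generalized Riemannian space in the sense of Eisenhart). Repeated indices are summed. Put $$\Gamma^i_{jk}=\tfrac12g^{\underline{i\alpha}}\big(g_{j\alpha,k}-g_{jk,\alpha}+g_{\alpha k,j}\big),\qquad \Gamma^i_{\underline{jk}}=\tfrac12(\Gamma^i_{jk}+\Gamma^i_{kj}),\qquad T^i_{jk}=\Gamma^i_{jk}-\Gamma^i_{kj},\qquad T_{ijk}=g_{\underline{i\alpha}}T^\alpha_{jk},$$ $$R^i_{jmn}=\Gamma^i_{\underline{jm},n}-\Gamma^i_{\underline{jn},m}+\Gamma^\alpha_{\underline{jm}}\Gamma^i_{\underline{\alpha n}}-\Gamma^\alpha_{\underline{jn}}\Gamma^i_{\underline{\alpha m}},\qquad R_{ij}=R^\alpha_{ij\alpha},\qquad R=g^{\underline{\alpha\beta}}R_{\alpha\beta}.$$ The torsion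 is regarded as a functional of the symmetric part of the metric, whose value at the given metric is $T_{\alpha\gamma\beta}$ and whose first variation there is $\delta T_{\alpha\gamma\beta}=v_{\alpha\gamma\beta ij}\,\delta g^{\underline{ij}}$ with coefficients $v_{\alpha\gamma\beta ij}=\dfrac{\delta T_{\alpha\gamma\beta}}{\delta g^{\underline{ij}}}$ symmetric in $i,j$. Define $$Q=g^{\underline{\gamma\delta}}g^{\underline{\epsilon\alpha}}g^{\underline{\beta\zeta}}T_{\alpha\gamma\beta}T_{\epsilon\delta\zeta},\qquad \tau_{ij}=\frac{\delta g^{\underline{\gamma\delta}}}{\delta g^{\underline{ij}}}g^{\underline{\epsilon\alpha}}g^{\underline{\beta\zeta}}T_{\epsilon\gamma\beta}T_{\alpha\delta\zeta},\qquad \mathcal W_{ij}=g^{\underline{\gamma\delta}}g^{\underline{\epsilon\alpha}}g^{\underline{\beta\zeta}}T_{\epsilon\delta\zeta}\frac{\delta T_{\alpha\gamma\beta}}{\delta g^{\underline{ij}}},$$ where $\dfrac{\delta g^{\underline{\gamma\delta}}}{\delta g^{\underline{ij}}}=\frac12(\delta^\gamma_i\delta^\delta_j+\delta^\gamma_j\delta^\delta_i)$,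 and write $A^\alpha_\alpha=g^{\underline{\alpha\beta}}A_{\alpha\beta}$. Let $\Lambda,v',w$ be real numbers, and suppose that the Einstein equations of motion $$R_{ij}-\tfrac12Rg_{\underline{ij}}+\Lambda g_{\underline{ij}}=\mathcal T_{ij},\qquad \mathcal T_{ij}:=(v'+w)\Big(3\tau_{ij}+2\mathcal W_{ij}-\tfrac12Q\,g_{\underline{ij}}\Big)$$ hold on $U$, with $\mathcal T_{ij}$ the energy-momentum tensor. Let $u^i$ be a vector field on $U$ with $u^\alpha u_\alpha=1$, where $u_i=g_{\underline{i\alpha}}u^\alpha$. With $h_{ij}=g_{\underline{ij}}-u_iu_j$ and $\Pi_{ij}=-\mathcal T_{\alpha\beta}h^\alpha_ih^\beta_j$, the pressure and the energy-density are $p=\frac13\Pi^\alpha_\alpha$ and $\rho=\mathcal T_{\alpha\beta}u^\alpha u^\beta$. **Claim.** At every point of $U$, the following hold. 1. (pEQM and ρEQM in the reference frame $u^i$) $$p=\tfrac13R_{\alpha\beta}u^\alpha u^\beta+\tfrac16R-\Lambda=-\tfrac13(v'+w)\Big[3\tau^\alpha_\alpha+2\mathcal W^\alpha_\alpha-\tfrac32Q-(3\tau_{\alpha\beta}+2\mathcal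 W_{\alpha\beta})u^\alpha u^\beta\Big],$$ $$\rho=R_{\alpha\beta}u^\alpha u^\beta-\tfrac12R+\Lambda=(v'+w)\Big[(3\tau_{\alpha\beta}+2\mathcal W_{\alpha\beta})u^\alpha u^\beta-\tfrac12Q\Big].$$ 2. (pEQM and ρEQM in the comoving frame) If $u^i=\delta^i_0$ at the point, then there, with $p_0=p$ and $\rho_0=\rho$, $$p_0=\tfrac13R_{00}+\tfrac16R-\Lambda=-\tfrac13(v'+w)\Big[3\tau^\alpha_\alpha+2\mathcal W^\alpha_\alpha-\tfrac32Q-3\tau_{00}-2\mathcal W_{00}\Big],$$ $$\rho_0=R_{00}-\tfrac12R+\Lambda=(v'+w)\Big[3\tau_{00}+2\mathcal W_{00}-\tfrac12Q\Big].$$ -/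

import Mathlib

open scoped ContDiff

noncomputable section

namespace GR4

/-- Coordinates `(x^0, x^1, x^2, x^3)` of a chart. -/
abbrev Coord : Type := Fin 4 → ℝ

/-- The partial derivative `f_{,k}` at `x`. -/
def pd (k : Fin 4) (f : Coord → ℝ) (x : Coord) : ℝ :=
  fderiv ℝ f x (Pi.single k 1)

/-- The symmetric part `½ (g_{ij} + g_{ji})` of a field of `4 × 4` matrices. -/
def symPart (g : Coord → Matrix (Fin 4) (Fin 4) ℝ) (x : Coord) : Matrix (Fin 4) (Fin 4) ℝ :=
  Matrix.of fun i j => (g x i j + g x j i) / 2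

/-- A generalized Riemannian space in the sense of Eisenhart, of dimension four, in a chart with
domain `U`: a smooth non-symmetric metric `g` whose symmetric part is non-singular. -/
structure Space where
  U : Set Coord
  isOpen_U : IsOpen U
  g : Coord → Matrix (Fin 4) (Fin 4) ℝ
  smooth_g : ∀ i j, ContDiffOn ℝ ∞ (fun x => g x i j) U
  nonsingular : ∀ x ∈ U, (symPart g x).det ≠ 0

namespace Space

variable (S : Space)

/-- The symmetric part of the metric, with lower indices. -/
def gs (x : Coord) : Matrix (Fin 4) (Fin 4) ℝ := symPart S.g x

/-- The contravariant symmetric part of the metric: the inverse matrix of the symmetric part. -/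
def gInv (x : Coord) : Matrix (Fin 4) (Fin 4) ℝ := (S.gs x)⁻¹

/-- Generalized Christoffel symbols of the second kind,
`Γ^i_{jk} = ½ g^{iα} (g_{jα,k} - g_{jk,α} + g_{αk,j})`. -/
def christoffel (i j k : Fin 4) (x : Coord) : ℝ :=
  (1 / 2) * ∑ a, S.gInv x i a *
    (pd k (fun y => S.g y j a) x - pd a (fun y => S.g y j k) x + pd j (fun y => S.g y a k) x)

/-- The symmetric part of `Γ^i_{jk}` in `j, k`. -/
def christoffelSym (i j k : Fin 4) (x : Coord) : ℝ :=
  (1 / 2) * (S.christoffel i j k x + S.christoffel i k j x)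

/-- The anti-symmetric part of `Γ^i_{jk}` in `j, k`. -/
def christoffelAnti (i j k : Fin 4) (x : Coord) : ℝ :=
  (1 / 2) * (S.christoffel i j k x - S.christoffel i k j x)

/-- The torsion tensor `T^i_{jk}`. -/
def torsion (i j k : Fin 4) (x : Coord) : ℝ := 2 * S.christoffelAnti i j k x

/-- The covariant torsion tensor `T_{ijk} = g_{iα} T^α_{jk}`. -/
def torsionCov (i j k : Fin 4) (x : Coord) : ℝ := ∑ a, S.gs x i a * S.torsion a j k x

/-- The curvature tensor `R^i_{jmn}` of the associated (symmetric) space. -/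
def riemann (i j m n : Fin 4) (x : Coord) : ℝ :=
  pd n (S.christoffelSym i j m) x - pd m (S.christoffelSym i j n) x
    + (∑ a, S.christoffelSym a j m x * S.christoffelSym i a n x)
    - ∑ a, S.christoffelSym a j n x * S.christoffelSym i a m x

/-- The Ricci tensor `R_{ij} = R^α_{ijα}` of the associated space. -/
def ricci (i j : Fin 4) (x : Coord) : ℝ := ∑ a, S.riemann a i j a x

/-- The trace `A^α_α = g^{αβ} A_{αβ}` of a tensor of type `(0,2)`. -/
def trace (A : Fin 4 → Fin 4 → Coord → ℝ) (x : Coord) : ℝ :=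
  ∑ a, ∑ b, S.gInv x a b * A a b x

/-- The scalar curvature `R = g^{αβ} R_{αβ}` of the associated space. -/
def scalar (x : Coord) : ℝ := S.trace S.ricci x

/-- The torsion scalar `g^{γδ} g^{εα} g^{βζ} T_{αγβ} T_{εδζ}`. -/
def torsionScalar (x : Coord) : ℝ :=
  ∑ c, ∑ d, ∑ e, ∑ a, ∑ b, ∑ z,
    S.gInv x c d * S.gInv x e a * S.gInv x b z * S.torsionCov a c b x * S.torsionCov e d z x

/-- The derivative `δg^{γδ} / δg^{ij}` of the components of the inverse metric with respect to
themselves; as `g^{ij}` is symmetric, it is the identity of the symmetric tensors. -/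
def deltaInv (c d i j : Fin 4) : ℝ :=
  ((if c = i ∧ d = j then 1 else 0) + (if c = j ∧ d = i then 1 else 0)) / 2

/-- `τ_{ij} = (δg^{γδ} / δg^{ij}) g^{εα} g^{βζ} T_{εγβ} T_{αδζ}`. -/
def tau (i j : Fin 4) (x : Coord) : ℝ :=
  ∑ c, ∑ d, ∑ e, ∑ a, ∑ b, ∑ z,
    deltaInv c d i j * S.gInv x e a * S.gInv x b z * S.torsionCov e c b x * S.torsionCov a d z x

/-- A smooth variation `δg^{ij}` of the inverse metric, compactly supported in the chart. -/
structure IsVariation (h : Coord → Matrix (Fin 4) (Fin 4) ℝ) : Prop where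
  smooth : ∀ i j, ContDiff ℝ ∞ fun x => h x i j
  symm : ∀ x i j, h x i j = h x j i
  compact : HasCompactSupport h
  supp : tsupport h ⊆ S.U

/-- The torsion enters the action as a functional of the symmetric part of the metric: a torsion
law `𝒯` assigns a covariant torsion field to each inverse symmetric metric. It belongs to the space
`S` when its value at the inverse metric of `S` is the torsion of `S`. -/
def IsTorsionLaw
    (𝒯 : (Coord → Matrix (Fin 4) (Fin 4) ℝ) → Fin 4 → Fin 4 → Fin 4 → Coord → ℝ) : Prop :=
  ∀ x ∈ S.U, ∀ a c b, 𝒯 S.gInv a c b x = S.torsionCov a c b x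

/-- `v_{αγβij}` are the variational derivatives `δT_{αγβ} / δg^{ij}` of the torsion law at the
metric of `S`: the first variation is `δT_{αγβ} = v_{αγβij} δg^{ij}`, with `v` symmetric in
`i, j`. -/
def IsTorsionDerivative
    (𝒯 : (Coord → Matrix (Fin 4) (Fin 4) ℝ) → Fin 4 → Fin 4 → Fin 4 → Coord → ℝ)
    (v : Fin 4 → Fin 4 → Fin 4 → Fin 4 → Fin 4 → Coord → ℝ) : Prop :=
  (∀ x ∈ S.U, ∀ a c b i j, v a c b i j x = v a c b j i x) ∧
  ∀ h, S.IsVariation h → ∀ x ∈ S.U, ∀ a c b,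
    HasDerivAt (fun s : ℝ => 𝒯 (fun y => S.gInv y + s • h y) a c b x)
      (∑ i, ∑ j, v a c b i j x * h x i j) 0

/-- `𝒲_{ij} = g^{γδ} g^{εα} g^{βζ} T_{εδζ} (δT_{αγβ} / δg^{ij})`, where `v` holds the variational
derivatives of the torsion. -/
def calW (v : Fin 4 → Fin 4 → Fin 4 → Fin 4 → Fin 4 → Coord → ℝ) (i j : Fin 4) (x : Coord) : ℝ :=
  ∑ c, ∑ d, ∑ e, ∑ a, ∑ b, ∑ z,
    S.gInv x c d * S.gInv x e a * S.gInv x b z * S.torsionCov e d z x * v a c b i j x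

/-- The energy-momentum tensor
`(v' + w) (3 τ_{ij} + 2 𝒲_{ij} - ½ g^{γδ} g^{εα} g^{βζ} T_{αγβ} T_{εδζ} g_{ij})`. -/
def energyMomentum (v' w : ℝ) (v : Fin 4 → Fin 4 → Fin 4 → Fin 4 → Fin 4 → Coord → ℝ)
    (i j : Fin 4) (x : Coord) : ℝ :=
  (v' + w) * (3 * S.tau i j x + 2 * S.calW v i j x - (1 / 2) * S.torsionScalar x * S.gs x i j)

/-- Einstein's equations of motion `R_{ij} - ½ R g_{ij} + Λ g_{ij} = T_{ij}` on the chart, with the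
energy-momentum tensor generated by the torsion. -/
def EquationsOfMotion (Λ v' w : ℝ) (v : Fin 4 → Fin 4 → Fin 4 → Fin 4 → Fin 4 → Coord → ℝ) :
    Prop :=
  ∀ x ∈ S.U, ∀ i j,
    S.ricci i j x - (1 / 2) * S.scalar x * S.gs x i j + Λ * S.gs x i j
      = S.energyMomentum v' w v i j x

/-- The full contraction `A_{αβ} u^α u^β`. -/
def along (A : Fin 4 → Fin 4 → Coord → ℝ) (u : Coord → Fin 4 → ℝ) (x : Coord) : ℝ :=
  ∑ a, ∑ b, A a b x * u x a * u x b

/-- `u^α u_α = 1` on the chart. -/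
def IsUnit (u : Coord → Fin 4 → ℝ) : Prop :=
  ∀ x ∈ S.U, ∑ a, ∑ b, S.gs x a b * u x a * u x b = 1

/-- The covector `u_i = g_{iα} u^α`. -/
def lower (u : Coord → Fin 4 → ℝ) (i : Fin 4) (x : Coord) : ℝ := ∑ a, S.gs x i a * u x a

/-- The tensor `h_{ij} = g_{ij} - u_i u_j`. -/
def proj (u : Coord → Fin 4 → ℝ) (i j : Fin 4) (x : Coord) : ℝ :=
  S.gs x i j - S.lower u i x * S.lower u j x

/-- The mixed tensor `h^k_i = g^{kα} h_{αi}`. -/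
def projMixed (u : Coord → Fin 4 → ℝ) (k i : Fin 4) (x : Coord) : ℝ :=
  ∑ a, S.gInv x k a * S.proj u a i x

/-- The tensor `Π_{ij} = - T_{αβ} h^α_i h^β_j` of an energy-momentum tensor `T`. -/
def stress (A : Fin 4 → Fin 4 → Coord → ℝ) (u : Coord → Fin 4 → ℝ) (i j : Fin 4) (x : Coord) : ℝ :=
  -∑ a, ∑ b, A a b x * S.projMixed u a i x * S.projMixed u b j x

/-- The pressure `p = ⅓ Π^α_α`. -/
def pressure (A : Fin 4 → Fin 4 → Coord → ℝ) (u : Coord → Fin 4 → ℝ) (x : Coord) : ℝ :=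
  (1 / 3) * S.trace (S.stress A u) x

/-- The energy-density `ρ = T_{αβ} u^α u^β`. -/
def density (A : Fin 4 → Fin 4 → Coord → ℝ) (u : Coord → Fin 4 → ℝ) (x : Coord) : ℝ :=
  along A u x

end Space

end GR4

end

/-!
The statement is linear algebra at a single point of the chart. The mixed tensor
`h^k_i = δ^k_i - u^k u_i` projects onto the `g`-orthogonal complement of the unit vector `u`, so
raising the indices of `h` gives `g^{ab} - u^a u^b`, and the trace of the stress tensor
`Π_{ij} = -A_{ab} h^a_i h^b_j` is `A_{ab} u^a u^b - A^a_a` for every tensor `A`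
(`trace_stress`, with its key step `sum_gInv_mul_projMixed_mul_projMixed`). The pressure and the
energy-density therefore depend on the energy-momentum tensor only through its trace and its
contraction along `u`. Both are linear, and on the metric they take the values `4` and `1`; applied
to the left-hand side of the equations of motion they give the expressions in the Ricci tensor, and
applied to the right-hand side those in the torsion.
-/

namespace GR4.Space

variable (S : Space) {x : Coord}

lemma gs_symm (i j : Fin 4) : S.gs x i j = S.gs x j i := by
  simp [gs, symPart, add_comm]

lemma gInv_symm (i j : Fin 4) : S.gInv x i j = S.gInv x j i := by
  have hG : (S.gs x).transpose = S.gs x := Matrix.ext fun i j => S.gs_symm j i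
  have hH : (S.gInv x).transpose = S.gInv x := by
    rw [gInv, Matrix.transpose_nonsing_inv, hG]
  exact congrFun (congrFun hH j) i

lemma sum_gInv_mul_gs (hx : x ∈ S.U) (i j : Fin 4) :
    ∑ a, S.gInv x i a * S.gs x a j = if i = j then 1 else 0 := by
  have h : S.gInv x * S.gs x = 1 :=
    Matrix.nonsing_inv_mul _ (isUnit_iff_ne_zero.mpr (S.nonsingular x hx))
  rw [← Matrix.mul_apply, h, Matrix.one_apply]

/-- Raising the index of `u_i` gives back `u^i`. -/
lemma sum_gInv_mul_lower (hx : x ∈ S.U) (u : Coord → Fin 4 → ℝ) (k : Fin 4) :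
    ∑ a, S.gInv x k a * S.lower u a x = u x k := by
  simp only [lower, Finset.mul_sum]
  rw [Finset.sum_comm]
  simp only [← mul_assoc, ← Finset.sum_mul, S.sum_gInv_mul_gs hx]
  simp

lemma projMixed_eq (hx : x ∈ S.U) (u : Coord → Fin 4 → ℝ) (k i : Fin 4) :
    S.projMixed u k i x = (if k = i then 1 else 0) - u x k * S.lower u i x := by
  simp only [projMixed, proj, mul_sub, Finset.sum_sub_distrib, S.sum_gInv_mul_gs hx,
    ← mul_assoc, ← Finset.sum_mul, S.sum_gInv_mul_lower hx]

lemma sum_lower_mul {u : Coord → Fin 4 → ℝ} (hu : S.IsUnit u) (hx : x ∈ S.U) :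
    ∑ i, S.lower u i x * u x i = 1 := by
  rw [← hu x hx]
  simp only [lower, Finset.sum_mul]
  exact Finset.sum_congr rfl fun i _ => Finset.sum_congr rfl fun j _ => by ring

/-- The contravariant projector: `g^{ij} h^a_i h^b_j = g^{ab} - u^a u^b`. -/
lemma sum_gInv_mul_projMixed_mul_projMixed {u : Coord → Fin 4 → ℝ} (hu : S.IsUnit u)
    (hx : x ∈ S.U) (a b : Fin 4) :
    ∑ i, ∑ j, S.gInv x i j * (S.projMixed u a i x * S.projMixed u b j x)
      = S.gInv x a b - u x a * u x b := by
  have inner (i : Fin 4) : ∑ j, S.gInv x i j * S.projMixed u b j x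
      = S.gInv x b i - u x b * u x i := by
    simp only [S.projMixed_eq hx, mul_sub, Finset.sum_sub_distrib]
    rw [← S.sum_gInv_mul_lower hx u i, Finset.mul_sum, S.gInv_symm b i]
    simp [mul_left_comm]
  calc _ = ∑ i, S.projMixed u a i x * (S.gInv x b i - u x b * u x i) := by
        refine Finset.sum_congr rfl fun i _ => ?_
        rw [← inner, Finset.mul_sum]
        exact Finset.sum_congr rfl fun j _ => by ring
    _ = (S.gInv x b a - u x b * u x a)
          - u x a * (∑ i, S.gInv x b i * S.lower u i x
            - u x b * ∑ i, S.lower u i x * u x i) := by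
        simp only [S.projMixed_eq hx, sub_mul, ite_mul, one_mul, zero_mul,
          Finset.sum_sub_distrib, Finset.sum_ite_eq, Finset.mem_univ, if_true]
        congr 1
        simp only [Finset.mul_sum, ← Finset.sum_sub_distrib]
        exact Finset.sum_congr rfl fun i _ => by ring
    _ = _ := by
        rw [S.sum_gInv_mul_lower hx, S.sum_lower_mul hu hx, S.gInv_symm b a]
        ring

lemma trace_stress (A : Fin 4 → Fin 4 → Coord → ℝ) {u : Coord → Fin 4 → ℝ} (hu : S.IsUnit u)
    (hx : x ∈ S.U) : S.trace (S.stress A u) x = along A u x - S.trace A x := by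
  have h : S.trace (S.stress A u) x
      = -∑ a, ∑ b, A a b x * ∑ i, ∑ j, S.gInv x i j *
          (S.projMixed u a i x * S.projMixed u b j x) := by
    simp only [trace, stress, mul_neg, Finset.sum_neg_distrib, Finset.mul_sum]
    congr 1
    rw [Finset.sum_comm_cycle]
    refine Finset.sum_congr rfl fun a _ => ?_
    rw [Finset.sum_comm_cycle]
    exact Finset.sum_congr rfl fun b _ => Finset.sum_congr rfl fun i _ =>
      Finset.sum_congr rfl fun j _ => by ring
  rw [h]
  simp only [S.sum_gInv_mul_projMixed_mul_projMixed hu hx, along, trace,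
    ← Finset.sum_sub_distrib, ← Finset.sum_neg_distrib]
  exact Finset.sum_congr rfl fun a _ => Finset.sum_congr rfl fun b _ => by ring

/-- For `A = k (B + c g)`, the trace of the metric contributes `4`, the dimension. -/
lemma trace_add_mul_gs (hx : x ∈ S.U) {A B : Fin 4 → Fin 4 → Coord → ℝ} {k c : ℝ}
    (h : ∀ i j, A i j x = k * (B i j x + c * S.gs x i j)) :
    S.trace A x = k * (S.trace B x + 4 * c) := by
  have hg : ∑ a, ∑ b, S.gInv x a b * S.gs x a b = 4 := by
    have (a : Fin 4) : ∑ b, S.gInv x a b * S.gs x a b = 1 := by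
      simpa [S.gs_symm a] using S.sum_gInv_mul_gs hx a a
    simp [this]
  rw [← hg]
  simp only [trace, h, Finset.mul_sum, Finset.sum_mul, ← Finset.sum_add_distrib]
  exact Finset.sum_congr rfl fun a _ => Finset.sum_congr rfl fun b _ => by ring

lemma along_add_mul_gs (hx : x ∈ S.U) {u : Coord → Fin 4 → ℝ} (hu : S.IsUnit u)
    {A B : Fin 4 → Fin 4 → Coord → ℝ} {k c : ℝ}
    (h : ∀ i j, A i j x = k * (B i j x + c * S.gs x i j)) :
    along A u x = k * (along B u x + c) := by
  rw [← mul_one c, ← hu x hx]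
  simp only [along, h, Finset.mul_sum, ← Finset.sum_add_distrib]
  exact Finset.sum_congr rfl fun a _ => Finset.sum_congr rfl fun b _ => by ring

lemma pressure_add_mul_gs (hx : x ∈ S.U) {u : Coord → Fin 4 → ℝ} (hu : S.IsUnit u)
    {A B : Fin 4 → Fin 4 → Coord → ℝ} {k c : ℝ}
    (h : ∀ i j, A i j x = k * (B i j x + c * S.gs x i j)) :
    S.pressure A u x = (1 / 3) * k * (along B u x - S.trace B x - 3 * c) := by
  rw [pressure, S.trace_stress A hu hx, S.along_add_mul_gs hx hu h, S.trace_add_mul_gs hx h]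
  ring

/-- The equations of motion, solved for the energy-momentum tensor; the factor `1` matches the shape
of `pressure_add_mul_gs` and `along_add_mul_gs`. -/
lemma EquationsOfMotion.energyMomentum_eq {Λ v' w : ℝ}
    {v : Fin 4 → Fin 4 → Fin 4 → Fin 4 → Fin 4 → Coord → ℝ}
    (h : S.EquationsOfMotion Λ v' w v) (hx : x ∈ S.U) (i j : Fin 4) :
    S.energyMomentum v' w v i j x
      = 1 * (S.ricci i j x + (Λ - (1 / 2) * S.scalar x) * S.gs x i j) := by
  rw [← h x hx]
  ring

/-- The tensor `3 τ_{ij} + 2 𝒲_{ij}`, the energy-momentum tensor up to scale and a multiple of the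
metric. -/
noncomputable def torsionSource (v : Fin 4 → Fin 4 → Fin 4 → Fin 4 → Fin 4 → Coord → ℝ)
    (i j : Fin 4) (x : Coord) : ℝ :=
  3 * S.tau i j x + 2 * S.calW v i j x

lemma energyMomentum_eq_torsionSource (v' w : ℝ)
    (v : Fin 4 → Fin 4 → Fin 4 → Fin 4 → Fin 4 → Coord → ℝ) (i j : Fin 4) :
    S.energyMomentum v' w v i j x = (v' + w) *
      (S.torsionSource v i j x + (-(1 / 2) * S.torsionScalar x) * S.gs x i j) := by
  rw [energyMomentum, torsionSource]
  ring

lemma trace_torsionSource (v : Fin 4 → Fin 4 → Fin 4 → Fin 4 → Fin 4 → Coord → ℝ) :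
    S.trace (S.torsionSource v) x = 3 * S.trace S.tau x + 2 * S.trace (S.calW v) x := by
  simp only [trace, torsionSource, Finset.mul_sum, ← Finset.sum_add_distrib]
  exact Finset.sum_congr rfl fun a _ => Finset.sum_congr rfl fun b _ => by ring

lemma along_of_comoving (A : Fin 4 → Fin 4 → Coord → ℝ) {u : Coord → Fin 4 → ℝ}
    (h : ∀ i, u x i = if i = 0 then 1 else 0) : along A u x = A 0 0 x := by
  simp [along, h]

end GR4.Space

theorem mainTheorem2 (S : GR4.Space) (Λ v' w : ℝ)
    (𝒯 : (GR4.Coord → Matrix (Fin 4) (Fin 4) ℝ) → Fin 4 → Fin 4 → Fin 4 → GR4.Coord → ℝ)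
    (v : Fin 4 → Fin 4 → Fin 4 → Fin 4 → Fin 4 → GR4.Coord → ℝ)
    (h𝒯 : S.IsTorsionLaw 𝒯) (hv : S.IsTorsionDerivative 𝒯 v)
    (hEOM : S.EquationsOfMotion Λ v' w v)
    (u : GR4.Coord → Fin 4 → ℝ) (hu : S.IsUnit u) :
    -- general frame: both expressions of the pressure, both expressions of the energy-density,
    -- and the two equations of equilibrium
    (∀ x ∈ S.U,
      (S.pressure (S.energyMomentum v' w v) u x
          = (1 / 3) * GR4.Space.along S.ricci u x + (1 / 6) * S.scalar x - Λ ∧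
        S.pressure (S.energyMomentum v' w v) u x
          = -(1 / 3) * (v' + w) * (3 * S.trace S.tau x + 2 * S.trace (S.calW v) x
              - (3 / 2) * S.torsionScalar x
              - GR4.Space.along (fun i j y => 3 * S.tau i j y + 2 * S.calW v i j y) u x) ∧
        (1 / 3) * GR4.Space.along S.ricci u x + (1 / 6) * S.scalar x - Λ
          = -(1 / 3) * (v' + w) * (3 * S.trace S.tau x + 2 * S.trace (S.calW v) x
              - (3 / 2) * S.torsionScalar x
              - GR4.Space.along (fun i j y => 3 * S.tau i j y + 2 * S.calW v i j y) u x)) ∧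
      (GR4.Space.density (S.energyMomentum v' w v) u x
          = GR4.Space.along S.ricci u x - (1 / 2) * S.scalar x + Λ ∧
        GR4.Space.density (S.energyMomentum v' w v) u x
          = (v' + w) * (GR4.Space.along (fun i j y => 3 * S.tau i j y + 2 * S.calW v i j y) u x
              - (1 / 2) * S.torsionScalar x) ∧
        GR4.Space.along S.ricci u x - (1 / 2) * S.scalar x + Λ
          = (v' + w) * (GR4.Space.along (fun i j y => 3 * S.tau i j y + 2 * S.calW v i j y) u x
              - (1 / 2) * S.torsionScalar x))) ∧
    -- comoving frame `u^i = δ^i_0`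
    (∀ x ∈ S.U, (∀ i, u x i = if i = 0 then 1 else 0) →
      (S.pressure (S.energyMomentum v' w v) u x
          = (1 / 3) * S.ricci 0 0 x + (1 / 6) * S.scalar x - Λ ∧
        S.pressure (S.energyMomentum v' w v) u x
          = -(1 / 3) * (v' + w) * (3 * S.trace S.tau x + 2 * S.trace (S.calW v) x
              - (3 / 2) * S.torsionScalar x - 3 * S.tau 0 0 x - 2 * S.calW v 0 0 x) ∧
        (1 / 3) * S.ricci 0 0 x + (1 / 6) * S.scalar x - Λ
          = -(1 / 3) * (v' + w) * (3 * S.trace S.tau x + 2 * S.trace (S.calW v) x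
              - (3 / 2) * S.torsionScalar x - 3 * S.tau 0 0 x - 2 * S.calW v 0 0 x)) ∧
      (GR4.Space.density (S.energyMomentum v' w v) u x
          = S.ricci 0 0 x - (1 / 2) * S.scalar x + Λ ∧
        GR4.Space.density (S.energyMomentum v' w v) u x
          = (v' + w) * (3 * S.tau 0 0 x + 2 * S.calW v 0 0 x - (1 / 2) * S.torsionScalar x) ∧
        S.ricci 0 0 x - (1 / 2) * S.scalar x + Λ
          = (v' + w) * (3 * S.tau 0 0 x + 2 * S.calW v 0 0 x
              - (1 / 2) * S.torsionScalar x))) := by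
  have hp₁ : ∀ x ∈ S.U, S.pressure (S.energyMomentum v' w v) u x
      = (1 / 3) * GR4.Space.along S.ricci u x + (1 / 6) * S.scalar x - Λ := fun x hx => by
    rw [S.pressure_add_mul_gs hx hu (hEOM.energyMomentum_eq S hx), ← GR4.Space.scalar]
    ring
  have hp₂ : ∀ x ∈ S.U, S.pressure (S.energyMomentum v' w v) u x
      = -(1 / 3) * (v' + w) * (3 * S.trace S.tau x + 2 * S.trace (S.calW v) x
          - (3 / 2) * S.torsionScalar x - GR4.Space.along (S.torsionSource v) u x) :=
    fun x hx => by
      rw [S.pressure_add_mul_gs hx hu (S.energyMomentum_eq_torsionSource v' w v),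
        S.trace_torsionSource]
      ring
  have hρ₁ : ∀ x ∈ S.U, GR4.Space.density (S.energyMomentum v' w v) u x
      = GR4.Space.along S.ricci u x - (1 / 2) * S.scalar x + Λ := fun x hx => by
    rw [GR4.Space.density, S.along_add_mul_gs hx hu (hEOM.energyMomentum_eq S hx)]
    ring
  have hρ₂ : ∀ x ∈ S.U, GR4.Space.density (S.energyMomentum v' w v) u x
      = (v' + w) * (GR4.Space.along (S.torsionSource v) u x - (1 / 2) * S.torsionScalar x) :=
    fun x hx => by
      rw [GR4.Space.density,
        S.along_add_mul_gs hx hu (S.energyMomentum_eq_torsionSource v' w v)]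
      ring
  refine ⟨fun x hx => ⟨⟨hp₁ x hx, hp₂ x hx, (hp₁ x hx).symm.trans (hp₂ x hx)⟩,
    ⟨hρ₁ x hx, hρ₂ x hx, (hρ₁ x hx).symm.trans (hρ₂ x hx)⟩⟩, fun x hx hcom => ?_⟩
  replace hp₁ := hp₁ x hx
  replace hp₂ := hp₂ x hx
  replace hρ₁ := hρ₁ x hx
  replace hρ₂ := hρ₂ x hx
  rw [GR4.Space.along_of_comoving _ hcom] at hp₁ hp₂ hρ₁ hρ₂
  rw [GR4.Space.torsionSource] at hp₂ hρ₂
  rw [← sub_sub] at hp₂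
  exact ⟨⟨hp₁, hp₂, hp₁.symm.trans hp₂⟩, ⟨hρ₁, hρ₂, hρ₁.symm.trans hρ₂⟩⟩
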